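/- Let $n\ge 1$ and let $A\in\mathbb{C}^{n\times n}$ have spectral abscissa $\alpha(A)=\max\{\operatorname{Re}\lambda:\lambda\in\Lambda(A)\}<0$, where $\Lambda(A)$ is the spectrum of $A$. Let $$\mathcal K(A)=\sup_{\operatorname{Re} z>0}(\operatorname{Re} z)\,\|(zI-A)^{-1}\|$$ be the continuous-time Kreiss constant of $A$ ($\|\cdot\|$ being the spectral norm), and for $x>0$, $y\in\mathbb{R}$ put $$g(x,y)=\sigma_{\min}\!\left(\frac{(x+\mathbf{i}y)I-A}{x}\right),$$ where $\sigma_{\min}$ denotes the smallest singular value. Let $\gamma\in[0,1)$ and $\eta\ge 0$, and let $(x_\star,y_\star)$, with $x_\star>0$, be a global minimizer of $g$ over $\{(x,y): x>0,\ y\in\mathbb{R}\}$. (i) If $\mathcal K(A)^{-1}\le\gamma$ and $\eta\le\frac{2x_\star}{1+\gamma}\left(\gamma-\mathcal K(A)^{-1}\right)$, then there exist $x>0$ and $y\in\mathbb{R}$ such that $$g(x,y)=g(x+\eta,y)=\gamma.$$ (ii) If there do not exist $x>0$ and $y\in\mathbb{R}$ with $g(x,y)=g(x+\eta,y)=\gamma$,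 then $$\mathcal K(A)^{-1}>\gamma-\frac{\eta(1+\gamma)}{2x_\star}.$$ -/

import Mathlib

open scoped ENNReal

namespace Kreiss

/-- The spectral abscissa `α(A)`: the largest real part of an eigenvalue of `A`. -/
noncomputable def spectralAbscissa {n : ℕ} (A : Matrix (Fin n) (Fin n) ℂ) : ℝ :=
  sSup (Complex.re '' spectrum ℂ A)

/-- The spectral norm of a complex square matrix: its operator norm on `ℂⁿ` with the Euclidean
norm. -/
noncomputable def spectralNorm {n : ℕ} (M : Matrix (Fin n) (Fin n) ℂ) : ℝ :=
  ‖Matrix.toEuclideanCLM (n := Fin n) (𝕜 := ℂ) M‖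

/-- The norm `‖(zI - A)⁻¹‖` of the resolvent, with the convention that it is `∞` when `z` is an
eigenvalue of `A`. -/
noncomputable def resolventNorm {n : ℕ} (A : Matrix (Fin n) (Fin n) ℂ) (z : ℂ) : ℝ≥0∞ :=
  open Classical in
  if z ∈ spectrum ℂ A then ∞
  else ENNReal.ofReal (spectralNorm ((z • (1 : Matrix (Fin n) (Fin n) ℂ) - A)⁻¹))

/-- The continuous-time Kreiss constant `𝒦(A) = sup {(Re z) ‖(zI - A)⁻¹‖ : Re z > 0}`,
with values in `[0, ∞]`. -/
noncomputable def kreissConstant {n : ℕ} (A : Matrix (Fin n) (Fin n) ℂ) : ℝ≥0∞ :=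
  ⨆ (z : ℂ) (_ : 0 < z.re), ENNReal.ofReal z.re * resolventNorm A z

/-- The inverse `𝒦(A)⁻¹` of the Kreiss constant, as a real number (it is `0` if `𝒦(A) = ∞`). -/
noncomputable def kreissInv {n : ℕ} (A : Matrix (Fin n) (Fin n) ℂ) : ℝ :=
  (kreissConstant A)⁻¹.toReal

/-- The smallest singular value of an `n × n` complex matrix, `n ≥ 1`. Singular values are listed
in decreasing order with indices `0, …, n - 1`. -/
noncomputable def sigmaMin {n : ℕ} (M : Matrix (Fin n) (Fin n) ℂ) : ℝ :=
  (Matrix.toEuclideanLin M).singularValues (n - 1)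

/-- `G(x, y) = ((x + i y) I - A) / x`, for `x ≠ 0`. -/
noncomputable def G {n : ℕ} (A : Matrix (Fin n) (Fin n) ℂ) (x y : ℝ) :
    Matrix (Fin n) (Fin n) ℂ :=
  (x : ℂ)⁻¹ • (((x : ℂ) + Complex.I * (y : ℂ)) • (1 : Matrix (Fin n) (Fin n) ℂ) - A)

/-- `g(x, y) = σ_min(G(x, y))`, for `x ≠ 0`. -/
noncomputable def g {n : ℕ} (A : Matrix (Fin n) (Fin n) ℂ) (x y : ℝ) : ℝ :=
  sigmaMin (G A x y)

/-- `(x, y)` is a global minimizer of `g` over the open right half-plane. -/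
def IsGlobalMinimizer {n : ℕ} (A : Matrix (Fin n) (Fin n) ℂ) (x y : ℝ) : Prop :=
  0 < x ∧ ∀ x' y' : ℝ, 0 < x' → g A x y ≤ g A x' y'

/-- There is a horizontal pair of points of the `γ`-level set of `g`, a distance `η` apart, in the
open right half-plane. -/
def HasHorizontalPair {n : ℕ} (A : Matrix (Fin n) (Fin n) ℂ) (γ η : ℝ) : Prop :=
  ∃ x y : ℝ, 0 < x ∧ g A x y = γ ∧ g A (x + η) y = γ

end Kreiss

/-!
Write `s z = σ_min (z I - A)`. This is a 1-Lipschitz function of `z`, it vanishes only on the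
spectrum, and `g (x, y) = s (x + i y) / x` for `x > 0`. With `φ z = s z - γ Re z`, the sublevel set
`{g ≤ γ}` is therefore `{φ ≤ 0}`: as `A` is stable, `φ > 0` on the closed left half-plane. The set
is bounded because `γ < 1` and `s z ≥ |z| - ‖A‖`.

Let `m` be the minimum of `g`, so that `0 < m ≤ 𝒦(A)⁻¹` (`le_kreissInv`). The Lipschitz bound
gives `φ ≤ 0` on the horizontal segment of half-length `r = xs (γ - m) / (1 + γ)` centred at the
minimizer, and the hypothesis on `η` gives `η ≤ 2 r`. Hence two points of one component of
`{φ ≤ 0}` lie at the horizontal distance `η`. What remains is topological: two *boundary* points of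
that component must lie at the same distance (`exists_eq_zero_and_add_eq_zero`). The reason is that
the outer boundary of the component and its translate by `-η` cannot be disjoint, since a compact
filled region neither contains nor is contained in a nontrivial translate of itself. This needs the
outer boundary to be connected, which is the unicoherence of the plane (`isPreconnected_frontier`),
obtained from the lifting of circle-valued maps on simply connected spaces.

Part (ii) is the contrapositive of part (i).
-/

open Set Topology
open scoped ENNReal

namespace Kreiss

/-! ### Plane topology -/

/-- A form of the unicoherence of simply connected spaces. If the frontier of a connected open set
`V` lies in a connected set `D` disjoint from `V`, it is connected. A separation of the frontier
gives a map to the circle that is `exp (-iπh)` on `closure V` and `exp (iπh)` elsewhere, where `h`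
is `0` on one piece and `1` on the other; going from one piece to the other through `V` and back
through `D`, this map winds once, so it cannot be lifted to `ℝ`. -/
theorem isPreconnected_frontier {X : Type*} [TopologicalSpace X] [SimplyConnectedSpace X]
    [LocallyPathConnectedSpace X] [NormalSpace X] {V D : Set X} (hVo : IsOpen V)
    (hV : IsPreconnected V) (hD : IsPreconnected D) (hVD : Disjoint D V)
    (hfr : frontier V ⊆ D) : IsPreconnected (frontier V) := by
  classical
  rw [isPreconnected_iff_subset_of_fully_disjoint_closed isClosed_frontier]
  intro P Q hP hQ hPQ hdisj
  by_contra! hcon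
  obtain ⟨q, hq, hqP⟩ := not_subset.1 hcon.1
  obtain ⟨p, hp, hpQ⟩ := not_subset.1 hcon.2
  replace hqP : q ∈ Q := (hPQ hq).resolve_left hqP
  replace hpQ : p ∈ P := (hPQ hp).resolve_right hpQ
  obtain ⟨h, h0, h1, -⟩ := exists_continuous_zero_one_of_isClosed hP hQ hdisj
  have hexp : ∀ z ∈ frontier V, Circle.exp (-(Real.pi * h z)) = Circle.exp (Real.pi * h z) := by
    intro z hz
    rcases hPQ hz with hz | hz
    · simp [h0 hz]
    · have := h1 hz
      simp only [Pi.one_apply] at this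
      ext
      simp [this, Circle.coe_exp, Complex.exp_pi_mul_I]
  let f : C(X, Circle) :=
    ⟨fun z => if z ∈ closure V then Circle.exp (-(Real.pi * h z)) else Circle.exp (Real.pi * h z),
      Continuous.if (fun z hz => hexp z (frontier_closure_subset hz))
        (Circle.exp.continuous.comp (by fun_prop)) (Circle.exp.continuous.comp (by fun_prop))⟩
  have hfV : ∀ z ∈ closure V, f z = Circle.exp (-(Real.pi * h z)) := fun z hz => if_pos hz
  have hfD : ∀ z ∈ D, f z = Circle.exp (Real.pi * h z) := by
    intro z hz
    by_cases hzV : z ∈ closure V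
    · rw [hfV z hzV, hexp z]
      rw [hVo.frontier_eq]
      exact ⟨hzV, disjoint_left.1 hVD hz⟩
    · exact if_neg hzV
  obtain ⟨φ, ⟨hφp, hφ⟩, -⟩ := Circle.isCoveringMap_exp.existsUnique_continuousMap_lifts f p 0
    (by rw [hfD p (hfr hp), h0 hpQ]; simp)
  have hφ' : ∀ z, Circle.exp (φ z) = f z := fun z => congrFun hφ z
  have hp0 : h p = 0 := h0 hpQ
  have hq1 : h q = 1 := h1 hqP
  have e1 : φ q = -(Real.pi * h q) :=
    Circle.isCoveringMap_exp.eqOn_of_comp_eqOn (g₁ := φ) (g₂ := fun z => -(Real.pi * h z))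
      hV.closure (by fun_prop) (by fun_prop)
      (fun z hz => by simp only [Function.comp, hφ', hfV z hz])
      (frontier_subset_closure hp) (by simp [hφp, hp0]) (frontier_subset_closure hq)
  have e2 : φ q = Real.pi * h q :=
    Circle.isCoveringMap_exp.eqOn_of_comp_eqOn (g₁ := φ) (g₂ := fun z => Real.pi * h z)
      hD (by fun_prop) (by fun_prop)
      (fun z hz => by simp only [Function.comp, hφ', hfD z hz])
      (hfr hp) (by simp [hφp, hp0]) (hfr hq)
  rw [hq1] at e1 e2
  linarith [Real.pi_pos]

theorem subset_or_disjoint_of_disjoint_frontier {X : Type*} [TopologicalSpace X] {V E : Set X}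
    (hV : IsOpen V) (hE : IsPreconnected E) (h : Disjoint E (frontier V)) :
    E ⊆ V ∨ Disjoint E V := by
  by_cases hne : (E ∩ V).Nonempty
  · left
    refine hE.subset_left_of_subset_union hV isClosed_closure.isOpen_compl
      (disjoint_compl_right.mono_left subset_closure) (fun z hz => ?_) hne
    by_cases hzV : z ∈ V
    · exact .inl hzV
    · refine .inr fun hzc => disjoint_left.1 h hz ?_
      rw [hV.frontier_eq]
      exact ⟨hzc, hzV⟩
  · right
    exact disjoint_iff_inter_eq_empty.2 (not_nonempty_iff_eq_empty.1 hne)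

theorem frontier_connectedComponentIn_compl_subset {X : Type*} [TopologicalSpace X]
    [LocallyConnectedSpace X] {D : Set X} (hD : IsClosed D) (w : X) :
    frontier (connectedComponentIn Dᶜ w) ⊆ D := by
  intro z hz
  by_contra hzD
  have hVo : IsOpen (connectedComponentIn Dᶜ w) := hD.isOpen_compl.connectedComponentIn
  rw [hVo.frontier_eq] at hz
  have hnhds : connectedComponentIn Dᶜ z ∈ 𝓝 z :=
    connectedComponentIn_mem_nhds (hD.isOpen_compl.mem_nhds hzD)
  obtain ⟨u, huz, huw⟩ := mem_closure_iff_nhds.1 hz.1 _ hnhds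
  apply hz.2
  rw [connectedComponentIn_eq huw, ← connectedComponentIn_eq huz]
  exact mem_connectedComponentIn hzD

theorem isPreconnected_setOf_lt_norm {R : ℝ} (hR : 0 < R) :
    IsPreconnected {z : ℂ | R < ‖z‖} := by
  have h : {z : ℂ | R < ‖z‖} = Complex.exp '' {z | Real.log R < z.re} := by
    ext z
    constructor
    · intro hz
      have hz0 : z ≠ 0 := norm_pos_iff.1 (hR.trans hz)
      refine ⟨Complex.log z, ?_, Complex.exp_log hz0⟩
      simpa [Complex.log_re] using Real.log_lt_log hR hz
    · rintro ⟨w, hw, rfl⟩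
      simpa [Complex.norm_exp] using (Real.log_lt_iff_lt_exp hR).1 hw
  rw [h]
  exact (convex_halfSpace_re_gt _).isPreconnected.image _ Complex.continuous_exp.continuousOn

theorem not_isBounded_of_add_mem {S : Set ℂ} {p w : ℂ} (hp : p ∈ S) (hw : w ≠ 0)
    (hS : ∀ z ∈ S, z + w ∈ S) : ¬ Bornology.IsBounded S := by
  intro hb
  obtain ⟨C, hC⟩ := hb.exists_norm_le
  have hmem : ∀ k : ℕ, p + k * w ∈ S := by
    intro k
    induction k with
    | zero => simpa using hp
    | succ k ih => convert hS _ ih using 1; push_cast; ring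
  obtain ⟨k, hk⟩ := exists_nat_gt ((C + ‖p‖) / ‖w‖)
  rw [div_lt_iff₀ (norm_pos_iff.2 hw)] at hk
  have h1 := hC _ (hmem k)
  have h2 : ‖(k : ℂ) * w‖ ≤ ‖p + k * w‖ + ‖p‖ := by
    simpa using norm_sub_le (p + k * w) p
  rw [norm_mul, Complex.norm_natCast] at h2
  linarith

/-- If a bounded sublevel set `{φ ≤ 0}` in the plane has a connected subset containing both `p` and
`p + w`, then the zero set of `φ` contains two points that differ by exactly `w`. Such points are
found on the outer frontier of the component `D` of `p`: if, for `w ≠ 0`, it missed its translate, it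
would, being connected, lie on one side of it, so that one of the two filled components, which
overlap, would be contained in the other; iterating the translation contradicts boundedness. -/
theorem exists_eq_zero_and_add_eq_zero {φ : ℂ → ℝ} (hφ : Continuous φ)
    (hb : Bornology.IsBounded {z | φ z ≤ 0}) {S : Set ℂ} (hS : IsPreconnected S)
    (hSφ : ∀ z ∈ S, φ z ≤ 0) {p w : ℂ} (hp : p ∈ S) (hpw : p + w ∈ S) :
    ∃ z, φ z = 0 ∧ φ (z + w) = 0 := by
  have hSF : S ⊆ {z | φ z ≤ 0} := hSφ
  have hFc : IsClosed {z | φ z ≤ 0} := isClosed_le hφ continuous_const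
  set D := connectedComponentIn {z | φ z ≤ 0} p with hDdef
  have hDF : D ⊆ {z | φ z ≤ 0} := connectedComponentIn_subset _ _
  have hDpre : IsPreconnected D := isPreconnected_connectedComponentIn
  have hSD : S ⊆ D := hS.subset_connectedComponentIn hp hSF
  have hDc : IsClosed D := by
    refine isClosed_of_closure_subset ?_
    exact hDpre.closure.subset_connectedComponentIn (subset_closure (hSD hp))
      (closure_minimal hDF hFc)
  obtain ⟨R, hR⟩ := hb.exists_norm_le
  set R' := max R 1 with hR'
  have hR'0 : 0 < R' := lt_max_of_lt_right one_pos
  set w₀ : ℂ := ((R' + 1 : ℝ) : ℂ) with hw₀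
  have hw₀n : w₀ ∈ {z : ℂ | R' < ‖z‖} := by
    change R' < ‖w₀‖
    rw [hw₀, Complex.norm_of_nonneg (by positivity)]
    linarith
  have hout : {z : ℂ | R' < ‖z‖} ⊆ Dᶜ := fun z hz hzD =>
    absurd (hR z (hDF hzD)) (not_le.2 ((le_max_left _ _).trans_lt hz))
  set V := connectedComponentIn Dᶜ w₀ with hVdef
  have hVo : IsOpen V := hDc.isOpen_compl.connectedComponentIn
  have hVpre : IsPreconnected V := isPreconnected_connectedComponentIn
  have hVout : {z : ℂ | R' < ‖z‖} ⊆ V :=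
    (isPreconnected_setOf_lt_norm hR'0).subset_connectedComponentIn hw₀n hout
  have hVD : Disjoint D V :=
    disjoint_left.2 fun z hz hzV => connectedComponentIn_subset _ _ hzV hz
  have hVb : Bornology.IsBounded Vᶜ := by
    refine (Metric.isBounded_closedBall (x := (0 : ℂ)) (r := R')).subset fun z hz => ?_
    rw [mem_closedBall_zero_iff]
    by_contra! h
    exact hz (hVout h)
  have hfrD : frontier V ⊆ D := frontier_connectedComponentIn_compl_subset hDc w₀
  have hpV : p ∉ V := disjoint_left.1 hVD (hSD hp)
  have hfr0 : ∀ z ∈ frontier V, φ z = 0 := by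
    intro z hz
    have hzD := hfrD hz
    refine le_antisymm (hDF hzD) (not_lt.1 fun hlt => ?_)
    have hn : {z | φ z ≤ 0} ∈ 𝓝 z :=
      Filter.mem_of_superset ((isOpen_lt hφ continuous_const).mem_nhds hlt) fun u (hu : φ u < 0) => hu.le
    have hDn : D ∈ 𝓝 z := by
      rw [hDdef, connectedComponentIn_eq hzD]
      exact connectedComponentIn_mem_nhds hn
    obtain ⟨u, huD, huV⟩ := mem_closure_iff_nhds.1 (frontier_subset_closure hz) _ hDn
    exact disjoint_left.1 hVD huD huV
  have hfrne : (frontier V).Nonempty := by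
    rw [nonempty_iff_ne_empty, Ne, frontier_eq_empty_iff]
    rintro (h | h)
    · have := hVout hw₀n
      simp [h] at this
    · exact hpV (h ▸ mem_univ p)
  by_cases hw : w = 0
  · obtain ⟨z, hz⟩ := hfrne
    exact ⟨z, hfr0 z hz, by rw [hw, add_zero]; exact hfr0 z hz⟩
  let T : ℂ ≃ₜ ℂ := Homeomorph.addRight w
  have hfrT : frontier (T ⁻¹' V) = T ⁻¹' frontier V := (T.preimage_frontier V).symm
  have hVT : IsPreconnected (T ⁻¹' V) := T.isPreconnected_preimage.2 hVpre
  have hDT : IsPreconnected (T ⁻¹' D) := T.isPreconnected_preimage.2 hDpre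
  have hVTo : IsOpen (T ⁻¹' V) := hVo.preimage T.continuous
  by_contra! hcon
  have hdis : Disjoint (frontier V) (frontier (T ⁻¹' V)) := by
    rw [hfrT]
    exact disjoint_left.2 fun z hz hz' => hcon z (hfr0 z hz) (hfr0 _ hz')
  -- Neither of the outer domains contains the other.
  have hn1 : ¬ T ⁻¹' V ⊆ V := fun h => not_isBounded_of_add_mem (S := Vᶜ) hpV hw
    (fun z hz hzw => hz (h hzw)) hVb
  have hn2 : ¬ V ⊆ T ⁻¹' V := fun h => not_isBounded_of_add_mem (S := Vᶜ) hpV (neg_ne_zero.2 hw)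
    (fun z hz hzw => hz (by simpa [T] using h hzw)) hVb
  have hmeet : (V ∩ T ⁻¹' V).Nonempty := by
    have hb' : Bornology.IsBounded (Vᶜ ∪ (T ⁻¹' V)ᶜ) := by
      refine hVb.union ?_
      obtain ⟨C, hC⟩ := hVb.exists_norm_le
      refine isBounded_iff_forall_norm_le.2 ⟨C + ‖w‖, fun z hz => ?_⟩
      have h1 := hC (z + w) hz
      have h2 : ‖z‖ ≤ ‖z + w‖ + ‖w‖ := by simpa using norm_sub_le (z + w) w
      linarith
    by_contra hne
    rw [not_nonempty_iff_eq_empty] at hne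
    rw [← compl_inter, hne, compl_empty] at hb'
    exact NormedSpace.unbounded_univ ℝ ℂ hb'
  rcases subset_or_disjoint_of_disjoint_frontier hVTo
    (isPreconnected_frontier hVo hVpre hDpre hVD hfrD) hdis with h | h
  · have hd : Disjoint (T ⁻¹' D) (frontier V) :=
      disjoint_left.2 fun z hz hz' => disjoint_left.1 hVD hz (h hz')
    rcases subset_or_disjoint_of_disjoint_frontier hVo hDT hd with h' | h'
    · exact hpV (h' (hSD hpw))
    · -- `V` is connected and misses the translate of `D`, in particular its outer frontier.
      have hd' : Disjoint V (frontier (T ⁻¹' V)) := by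
        rw [hfrT]
        exact h'.symm.mono_right (preimage_mono hfrD)
      rcases subset_or_disjoint_of_disjoint_frontier hVTo hVpre hd' with h'' | h''
      · exact hn2 h''
      · exact hmeet.ne_empty h''.inter_eq
  · rcases subset_or_disjoint_of_disjoint_frontier hVo hVT h.symm with h' | h'
    · exact hn1 h'
    · exact hmeet.ne_empty h'.symm.inter_eq

/-! ### The smallest singular value -/

variable {n : ℕ}

theorem norm_sq_eq_re_inner_adjoint_comp {E : Type*} [NormedAddCommGroup E] [InnerProductSpace ℂ E]
    [FiniteDimensional ℂ E] (T : E →ₗ[ℂ] E) (v : E) :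
    ‖T v‖ ^ 2 = (inner ℂ v ((T.adjoint ∘ₗ T) v)).re := by
  rw [LinearMap.comp_apply, LinearMap.adjoint_inner_right, inner_self_eq_norm_sq_to_K]
  norm_cast

theorem sigmaMin_nonneg (M : Matrix (Fin n) (Fin n) ℂ) : 0 ≤ sigmaMin M :=
  LinearMap.singularValues_nonneg _ _

/-- Expansion in an eigenbasis of `Mᴴ M`, whose eigenvalues are all at least `σ_min ^ 2`. -/
theorem sigmaMin_mul_norm_le (M : Matrix (Fin n) (Fin n) ℂ)
    (v : EuclideanSpace ℂ (Fin n)) : sigmaMin M * ‖v‖ ≤ ‖Matrix.toEuclideanLin M v‖ := by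
  set T := Matrix.toEuclideanLin M with hT
  have hfr : Module.finrank ℂ (EuclideanSpace ℂ (Fin n)) = n := by simp
  have hsym := T.isSymmetric_adjoint_comp_self
  let b := hsym.eigenvectorBasis hfr
  have hlow : ∀ i, sigmaMin M ^ 2 ≤ hsym.eigenvalues hfr i := by
    intro i
    rw [← T.sq_singularValues_fin hfr i]
    exact pow_le_pow_left₀ (sigmaMin_nonneg M)
      (T.singularValues_antitone (Nat.le_sub_one_of_lt i.2)) 2
  have hsum : ‖T v‖ ^ 2 = ∑ i, hsym.eigenvalues hfr i * ‖b.repr v i‖ ^ 2 := by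
    rw [norm_sq_eq_re_inner_adjoint_comp, ← b.repr.inner_map_map, PiLp.inner_apply, Complex.re_sum]
    refine Finset.sum_congr rfl fun i _ => ?_
    rw [hsym.eigenvectorBasis_apply_self_apply hfr v i]
    simp only [RCLike.inner_apply, RCLike.ofReal_eq_complex_ofReal]
    rw [mul_assoc, Complex.mul_conj, ← Complex.ofReal_mul, Complex.ofReal_re,
      Complex.normSq_eq_norm_sq]
  have hv : ‖v‖ ^ 2 = ∑ i, ‖b.repr v i‖ ^ 2 := by
    rw [← b.repr.norm_map, EuclideanSpace.norm_sq_eq]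
  refine le_of_sq_le_sq ?_ (norm_nonneg _)
  rw [mul_pow, hv, hsum, Finset.mul_sum]
  exact Finset.sum_le_sum fun i _ => mul_le_mul_of_nonneg_right (hlow i) (sq_nonneg _)

theorem exists_norm_eq_sigmaMin (hn : 0 < n) (M : Matrix (Fin n) (Fin n) ℂ) :
    ∃ v : EuclideanSpace ℂ (Fin n), ‖v‖ = 1 ∧ ‖Matrix.toEuclideanLin M v‖ = sigmaMin M := by
  set T := Matrix.toEuclideanLin M with hT
  obtain ⟨v, hv⟩ := (T.hasEigenvalue_adjoint_comp_self_sq_singularValues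
    (n := n - 1) (by simpa using hn)).exists_hasEigenvector
  have hv0 : ‖v‖ ≠ 0 := norm_ne_zero_iff.2 hv.2
  have key : ‖T v‖ = sigmaMin M * ‖v‖ := by
    rw [← sq_eq_sq₀ (norm_nonneg _) (mul_nonneg (sigmaMin_nonneg M) (norm_nonneg _)),
      norm_sq_eq_re_inner_adjoint_comp, hv.apply_eq_smul, inner_smul_right,
      inner_self_eq_norm_sq_to_K, mul_pow]
    norm_cast
  refine ⟨((‖v‖ : ℂ)⁻¹) • v, ?_, ?_⟩
  · rw [norm_smul, norm_inv, Complex.norm_real, norm_norm, inv_mul_cancel₀ hv0]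
  · rw [map_smul, norm_smul, norm_inv, Complex.norm_real, norm_norm, key]
    field_simp

theorem sigmaMin_smul (hn : 0 < n) (c : ℂ) (M : Matrix (Fin n) (Fin n) ℂ) :
    sigmaMin (c • M) = ‖c‖ * sigmaMin M := by
  have key : ∀ v, ‖Matrix.toEuclideanLin (c • M) v‖ = ‖c‖ * ‖Matrix.toEuclideanLin M v‖ := by
    intro v
    rw [map_smul, LinearMap.smul_apply, norm_smul]
  obtain ⟨v, hv1, hv⟩ := exists_norm_eq_sigmaMin hn M
  obtain ⟨u, hu1, hu⟩ := exists_norm_eq_sigmaMin hn (c • M)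
  have h1 := sigmaMin_mul_norm_le (c • M) v
  have h2 := sigmaMin_mul_norm_le M u
  rw [key, hv, hv1, mul_one] at h1
  rw [key] at hu
  rw [hu1, mul_one] at h2
  exact le_antisymm h1 (hu ▸ mul_le_mul_of_nonneg_left h2 (norm_nonneg c))

/-- The function `z ↦ σ_min (z I - A)`. -/
noncomputable def shiftSigma (A : Matrix (Fin n) (Fin n) ℂ) (z : ℂ) : ℝ :=
  sigmaMin (z • (1 : Matrix (Fin n) (Fin n) ℂ) - A)

theorem toEuclideanLin_shift_apply (A : Matrix (Fin n) (Fin n) ℂ) (z : ℂ)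
    (v : EuclideanSpace ℂ (Fin n)) :
    Matrix.toEuclideanLin (z • (1 : Matrix (Fin n) (Fin n) ℂ) - A) v
      = z • v - Matrix.toEuclideanLin A v := by
  simp [map_sub, LinearMap.sub_apply, Matrix.toLpLin_one]

theorem shiftSigma_le_add (hn : 0 < n) (A : Matrix (Fin n) (Fin n) ℂ) (z w : ℂ) :
    shiftSigma A z ≤ shiftSigma A w + ‖z - w‖ := by
  obtain ⟨v, hv1, hv⟩ := exists_norm_eq_sigmaMin hn (w • (1 : Matrix (Fin n) (Fin n) ℂ) - A)
  have h := sigmaMin_mul_norm_le (z • (1 : Matrix (Fin n) (Fin n) ℂ) - A) v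
  rw [hv1, mul_one] at h
  refine h.trans ?_
  have e : Matrix.toEuclideanLin (z • (1 : Matrix (Fin n) (Fin n) ℂ) - A) v
      = Matrix.toEuclideanLin (w • (1 : Matrix (Fin n) (Fin n) ℂ) - A) v + (z - w) • v := by
    rw [toEuclideanLin_shift_apply, toEuclideanLin_shift_apply, sub_smul]
    abel
  rw [e]
  refine (norm_add_le _ _).trans ?_
  rw [hv, norm_smul, hv1, mul_one, shiftSigma]

theorem continuous_shiftSigma (hn : 0 < n) (A : Matrix (Fin n) (Fin n) ℂ) :
    Continuous (shiftSigma A) := by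
  refine (LipschitzWith.of_le_add_mul 1 fun z w => ?_).continuous
  rw [NNReal.coe_one, one_mul, dist_eq_norm]
  exact shiftSigma_le_add hn A z w

theorem norm_le_shiftSigma_add (hn : 0 < n) (A : Matrix (Fin n) (Fin n) ℂ) (z : ℂ) :
    ‖z‖ ≤ shiftSigma A z + spectralNorm A := by
  obtain ⟨v, hv1, hv⟩ := exists_norm_eq_sigmaMin hn (z • (1 : Matrix (Fin n) (Fin n) ℂ) - A)
  rw [toEuclideanLin_shift_apply] at hv
  have hA : ‖Matrix.toEuclideanLin A v‖ ≤ spectralNorm A := by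
    have := (Matrix.toEuclideanCLM (n := Fin n) (𝕜 := ℂ) A).le_opNorm v
    rwa [hv1, mul_one] at this
  have h1 : ‖z • v‖ ≤ ‖z • v - Matrix.toEuclideanLin A v‖ + ‖Matrix.toEuclideanLin A v‖ := by
    simpa using norm_add_le (z • v - Matrix.toEuclideanLin A v) (Matrix.toEuclideanLin A v)
  rw [norm_smul, hv1, mul_one, hv] at h1
  exact h1.trans (by rw [shiftSigma]; linarith)

theorem isUnit_shift_iff {A : Matrix (Fin n) (Fin n) ℂ} {z : ℂ} :
    IsUnit (z • (1 : Matrix (Fin n) (Fin n) ℂ) - A) ↔ z ∉ spectrum ℂ A := by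
  rw [spectrum.notMem_iff, Algebra.algebraMap_eq_smul_one]

/-- The resolvent is bounded by the reciprocal of the smallest singular value, in a form that needs
no division. -/
theorem shiftSigma_mul_spectralNorm_inv_le {A : Matrix (Fin n) (Fin n) ℂ} {z : ℂ}
    (hz : z ∉ spectrum ℂ A) :
    shiftSigma A z * spectralNorm ((z • (1 : Matrix (Fin n) (Fin n) ℂ) - A)⁻¹) ≤ 1 := by
  set M := z • (1 : Matrix (Fin n) (Fin n) ℂ) - A with hM
  have hu : IsUnit M.det := (Matrix.isUnit_iff_isUnit_det _).1 (isUnit_shift_iff.2 hz)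
  rcases (sigmaMin_nonneg M).eq_or_lt with h0 | hpos
  · rw [shiftSigma, ← hM, ← h0]; simp
  · rw [shiftSigma, ← hM, ← le_div_iff₀' hpos, spectralNorm]
    refine ContinuousLinearMap.opNorm_le_bound _ (by positivity) fun v => ?_
    have h := sigmaMin_mul_norm_le M (Matrix.toEuclideanCLM (n := Fin n) (𝕜 := ℂ) M⁻¹ v)
    have e : Matrix.toEuclideanLin M (Matrix.toEuclideanCLM (n := Fin n) (𝕜 := ℂ) M⁻¹ v) = v := by
      rw [← Matrix.coe_toEuclideanCLM_eq_toEuclideanLin, ContinuousLinearMap.coe_coe,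
        ← mul_apply_eq_comp, ← map_mul, Matrix.mul_nonsing_inv _ hu, map_one,
        one_apply_eq_self]
    rw [e] at h
    rw [one_div, inv_mul_eq_div, le_div_iff₀' hpos]
    exact h

theorem shiftSigma_pos (hn : 0 < n) {A : Matrix (Fin n) (Fin n) ℂ} {z : ℂ}
    (hz : z ∉ spectrum ℂ A) : 0 < shiftSigma A z := by
  refine (sigmaMin_nonneg _).lt_of_ne' fun h0 => ?_
  obtain ⟨v, hv1, hv⟩ := exists_norm_eq_sigmaMin hn (z • (1 : Matrix (Fin n) (Fin n) ℂ) - A)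
  rw [h0, norm_eq_zero] at hv
  set M := z • (1 : Matrix (Fin n) (Fin n) ℂ) - A with hM
  have hu : IsUnit M.det := (Matrix.isUnit_iff_isUnit_det _).1 (isUnit_shift_iff.2 hz)
  have e : Matrix.toEuclideanCLM (n := Fin n) (𝕜 := ℂ) M⁻¹
      (Matrix.toEuclideanCLM (n := Fin n) (𝕜 := ℂ) M v) = v := by
    rw [← mul_apply_eq_comp, ← map_mul, Matrix.nonsing_inv_mul _ hu, map_one,
        one_apply_eq_self]
  rw [← ContinuousLinearMap.coe_coe (Matrix.toEuclideanCLM (n := Fin n) (𝕜 := ℂ) M),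
    Matrix.coe_toEuclideanCLM_eq_toEuclideanLin, hv, map_zero] at e
  simp [← e] at hv1

theorem g_eq_shiftSigma_div (hn : 0 < n) (A : Matrix (Fin n) (Fin n) ℂ) {x : ℝ} (hx : 0 < x)
    (y : ℝ) : g A x y = shiftSigma A (⟨x, y⟩ : ℂ) / x := by
  have hz : (x : ℂ) + Complex.I * (y : ℂ) = ⟨x, y⟩ := by
    apply Complex.ext <;> simp
  rw [g, G, hz, sigmaMin_smul hn, norm_inv,
    Complex.norm_real, Real.norm_of_nonneg hx.le, shiftSigma, inv_mul_eq_div]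

theorem notMem_spectrum_of_re_nonneg {A : Matrix (Fin n) (Fin n) ℂ}
    (hA : spectralAbscissa A < 0) {z : ℂ} (hz : 0 ≤ z.re) : z ∉ spectrum ℂ A := fun h =>
  hA.not_ge (hz.trans (le_csSup (A.finite_spectrum.image _).bddAbove (mem_image_of_mem _ h)))

/-! ### The Kreiss constant -/

theorem kreissConstant_ne_zero (hn : 0 < n) {A : Matrix (Fin n) (Fin n) ℂ}
    (hA : spectralAbscissa A < 0) : kreissConstant A ≠ 0 := by
  have : Nonempty (Fin n) := ⟨⟨0, hn⟩⟩
  have hz : (1 : ℂ) ∉ spectrum ℂ A := notMem_spectrum_of_re_nonneg hA (by simp)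
  intro h
  simp only [kreissConstant, ENNReal.iSup_eq_zero] at h
  have h1 := h 1 (by simp)
  rw [resolventNorm, if_neg hz] at h1
  simp only [Complex.one_re, ENNReal.ofReal_one, one_mul, ENNReal.ofReal_eq_zero] at h1
  have h2 : Matrix.toEuclideanCLM (n := Fin n) (𝕜 := ℂ)
      (((1 : ℂ) • (1 : Matrix (Fin n) (Fin n) ℂ) - A)⁻¹) = 0 := norm_le_zero_iff.1 h1
  rw [EmbeddingLike.map_eq_zero_iff] at h2
  have hu := (Matrix.isUnit_iff_isUnit_det _).1 (isUnit_shift_iff.2 hz)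
  have h3 := Matrix.mul_nonsing_inv _ hu
  rw [h2, mul_zero] at h3
  exact zero_ne_one h3

/-- A positive lower bound `m` of `g` over the half-plane is a lower bound of `𝒦(A)⁻¹`. That
`𝒦(A) ≠ 0` matters, since otherwise `𝒦(A)⁻¹ = ∞` would be read as the real number `0`. -/
theorem le_kreissInv (hn : 0 < n) {A : Matrix (Fin n) (Fin n) ℂ}
    (hA : spectralAbscissa A < 0) {m : ℝ} (hm : 0 < m)
    (hg : ∀ x y : ℝ, 0 < x → m ≤ g A x y) : m ≤ kreissInv A := by
  have hK : kreissConstant A ≤ ENNReal.ofReal m⁻¹ := by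
    refine iSup₂_le fun z hz => ?_
    have hzs := notMem_spectrum_of_re_nonneg hA hz.le
    rw [resolventNorm, if_neg hzs, ← ENNReal.ofReal_mul hz.le]
    refine ENNReal.ofReal_le_ofReal ?_
    have h1 := hg z.re z.im hz
    rw [g_eq_shiftSigma_div hn A hz, le_div_iff₀ hz] at h1
    have h2 := shiftSigma_mul_spectralNorm_inv_le hzs
    set N := spectralNorm ((z • (1 : Matrix (Fin n) (Fin n) ℂ) - A)⁻¹)
    have hN : 0 ≤ N := norm_nonneg _
    rw [← one_div, le_div_iff₀' hm, ← mul_assoc]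
    exact (mul_le_mul_of_nonneg_right h1 hN).trans h2
  rw [kreissInv, ← ENNReal.toReal_ofReal hm.le]
  refine ENNReal.toReal_mono (ENNReal.inv_ne_top.2 (kreissConstant_ne_zero hn hA)) ?_
  rw [ENNReal.le_inv_iff_le_inv, ← ENNReal.ofReal_inv_of_pos hm]
  exact hK

/-! ### The level set -/

/-- The horizontal pair exists as soon as `(xs, ys)` is any point of the half-plane with
`g (xs, ys) ≤ γ` and `η` is at most the stated multiple of `γ - g (xs, ys)`. For `x > 0` the
conditions `g = γ` and `g ≤ γ` read `φ = 0` and `φ ≤ 0` with `φ z = σ_min (z I - A) - γ Re z`,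
a function that is continuous on all of `ℂ` and positive on the closed left half-plane. -/
theorem hasHorizontalPair_of_le (hn : 0 < n) {A : Matrix (Fin n) (Fin n) ℂ}
    (hA : spectralAbscissa A < 0) {γ η xs ys : ℝ} (hγ1 : γ < 1) (hη : 0 ≤ η) (hxs : 0 < xs)
    (hm : 0 < g A xs ys) (hmγ : g A xs ys ≤ γ)
    (hle : η ≤ 2 * xs / (1 + γ) * (γ - g A xs ys)) : HasHorizontalPair A γ η := by
  set m := g A xs ys with hmdef
  have hγ : 0 < γ := hm.trans_le hmγ
  have hms : shiftSigma A ⟨xs, ys⟩ = m * xs := by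
    rw [hmdef, g_eq_shiftSigma_div hn A hxs, div_mul_cancel₀ _ hxs.ne']
  let φ : ℂ → ℝ := fun z => shiftSigma A z - γ * z.re
  have hφ : Continuous φ :=
    (continuous_shiftSigma hn A).sub (continuous_const.mul Complex.continuous_re)
  have hre : ∀ z, φ z ≤ 0 → 0 < z.re := by
    intro z hz
    simp only [φ] at hz
    by_contra! h
    rcases h.eq_or_lt with h0 | hneg
    · have := shiftSigma_pos hn (notMem_spectrum_of_re_nonneg hA h0.ge)
      rw [h0] at hz
      linarith
    · have := sigmaMin_nonneg (z • (1 : Matrix (Fin n) (Fin n) ℂ) - A)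
      have h2 := mul_neg_of_pos_of_neg hγ hneg
      rw [shiftSigma] at hz
      linarith
  have hb : Bornology.IsBounded {z | φ z ≤ 0} := by
    refine isBounded_iff_forall_norm_le.2 ⟨spectralNorm A / (1 - γ), fun z (hz : φ z ≤ 0) => ?_⟩
    have h1 := norm_le_shiftSigma_add hn A z
    have h2 := mul_le_mul_of_nonneg_left (Complex.re_le_norm z) hγ.le
    simp only [φ] at hz
    rw [le_div_iff₀ (by linarith)]
    linarith
  -- By the Lipschitz bound, `φ ≤ 0` on the horizontal segment of half-length `r` about the
  -- minimizer; `r` is dictated by the left half, where `γ * x` decreases.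
  set r := xs * (γ - m) / (1 + γ) with hr
  have hr0 : 0 ≤ r := by have := sub_nonneg.2 hmγ; positivity
  have hr' : r * (1 + γ) = xs * (γ - m) := div_mul_cancel₀ _ (by positivity)
  have hηr : η ≤ 2 * r := by
    refine hle.trans_eq ?_
    rw [hr]; ring
  let S : Set ℂ := (fun x : ℝ => (⟨x, ys⟩ : ℂ)) '' Icc (xs - r) (xs + r)
  have hcont : Continuous fun x : ℝ => (⟨x, ys⟩ : ℂ) := by
    have : (fun x : ℝ => (⟨x, ys⟩ : ℂ)) = fun x : ℝ => (x : ℂ) + ys * Complex.I := by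
      funext x; apply Complex.ext <;> simp
    rw [this]; fun_prop
  have hS : IsPreconnected S := isPreconnected_Icc.image _ hcont.continuousOn
  have hSφ : ∀ z ∈ S, φ z ≤ 0 := by
    rintro _ ⟨x, hx, rfl⟩
    have h1 := shiftSigma_le_add hn A ⟨x, ys⟩ ⟨xs, ys⟩
    have h2 : ‖(⟨x, ys⟩ : ℂ) - ⟨xs, ys⟩‖ = |x - xs| := by
      have : (⟨x, ys⟩ : ℂ) - ⟨xs, ys⟩ = ((x - xs : ℝ) : ℂ) := by
        apply Complex.ext <;> simp
      rw [this, Complex.norm_real, Real.norm_eq_abs]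
    rw [h2, hms] at h1
    simp only [φ]
    have h3 := mul_nonneg hγ.le hr0
    rcases abs_cases (x - xs) with ⟨h4, h5⟩ | ⟨h4, h5⟩ <;> rw [h4] at h1
    · have := mul_nonneg h5 hγ.le
      linarith [hx.2]
    · have := mul_le_mul_of_nonneg_right (show xs - r ≤ x from hx.1)
        (show 0 ≤ 1 + γ by positivity)
      linarith
  have hp : (⟨xs - r, ys⟩ : ℂ) ∈ S := ⟨xs - r, ⟨le_rfl, by linarith⟩, rfl⟩
  have hpw : (⟨xs - r, ys⟩ : ℂ) + (η : ℂ) ∈ S := by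
    refine ⟨xs - r + η, ⟨by linarith, by linarith⟩, ?_⟩
    apply Complex.ext <;> simp
  obtain ⟨z, hz, hzη⟩ := exists_eq_zero_and_add_eq_zero hφ hb hS hSφ hp hpw
  have hlevel : ∀ x y : ℝ, φ ⟨x, y⟩ = 0 → g A x y = γ := by
    intro x y h
    have hx : 0 < x := hre _ h.le
    rw [g_eq_shiftSigma_div hn A hx, div_eq_iff hx.ne']
    exact sub_eq_zero.1 h
  refine ⟨z.re, z.im, hre z hz.le, hlevel _ _ hz, hlevel _ _ ?_⟩
  convert hzη using 2
  apply Complex.ext <;> simp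

end Kreiss

theorem theorem4p4 {n : ℕ} (hn : 0 < n) (A : Matrix (Fin n) (Fin n) ℂ)
    (hA : Kreiss.spectralAbscissa A < 0)
    (γ η : ℝ) (hγ0 : 0 ≤ γ) (hγ1 : γ < 1) (hη : 0 ≤ η)
    (xs ys : ℝ) (hmin : Kreiss.IsGlobalMinimizer A xs ys) :
    (Kreiss.kreissInv A ≤ γ →
      η ≤ 2 * xs / (1 + γ) * (γ - Kreiss.kreissInv A) →
      Kreiss.HasHorizontalPair A γ η) ∧
    (¬ Kreiss.HasHorizontalPair A γ η →
      Kreiss.kreissInv A > γ - η * (1 + γ) / (2 * xs)) := by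
  obtain ⟨hxs, hmin⟩ := hmin
  have hm : 0 < Kreiss.g A xs ys := by
    rw [Kreiss.g_eq_shiftSigma_div hn A hxs]
    exact div_pos (Kreiss.shiftSigma_pos hn (Kreiss.notMem_spectrum_of_re_nonneg hA hxs.le)) hxs
  have hmK : Kreiss.g A xs ys ≤ Kreiss.kreissInv A := Kreiss.le_kreissInv hn hA hm hmin
  have main : Kreiss.kreissInv A ≤ γ →
      η ≤ 2 * xs / (1 + γ) * (γ - Kreiss.kreissInv A) → Kreiss.HasHorizontalPair A γ η :=
    fun hK hle => Kreiss.hasHorizontalPair_of_le hn hA hγ1 hη hxs hm (hmK.trans hK)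
      (hle.trans (mul_le_mul_of_nonneg_left (by linarith) (by positivity)))
  refine ⟨main, fun hno => ?_⟩
  by_contra! hK
  refine hno (main (hK.trans (sub_le_self _ (by positivity))) ?_)
  have h : η = 2 * xs / (1 + γ) * (η * (1 + γ) / (2 * xs)) := by
    field_simp
  rw [h]
  exact mul_le_mul_of_nonneg_left (by linarith) (by positivity)
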